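/- \textbf{Conventions.} A permutation group $G\curvearrowright M$ is a countable set $M$ together with a closed subgroup $G$ of $\mathrm{Sym}(M)$ (for the topology of pointwise convergence); it is oligomorphic if $G$ has finitely many orbits on $M^n$ for every $n$. To $G\curvearrowright M$ we associate the canonical first-order structure on $M$ having an $n$-ary relation for each $G$-orbit on $M^n$; its automorphism group is $G$, and its semigroup of elementary self-embeddings is the left-completion $\overline G$ of $G$, i.e. the closure of $G$ in $M^M$. Let $\Omega=[0,1]$ and $\Omega^2=[0,1]^2$ with Lebesgue measure $\mu$. We say that $G$ has \emph{approximable random endomorphisms} if for every measurable $\hat h\colon\Omega^2\to\overline G$ and every $\epsilon>0$ there is a measurable $\hat g\colon\Omega^2\to G$ such that for every measurable $f\colon\Omega\to M$, $$\mu\{(\omega,\omega')\in\Omega^2 : \hat g(\omega,\omega')(f(\omega))\neq \hat h(\omega,\omega')(f(\omega))\}<\epsilon .$$ For permutation groups $G\curvearrowright M$ and $H\curvearrowright N$: the direct product $G\times H$ acts on $M\sqcup N$ by $(g,h)a=ga$ for $a\in M$ and $(g,h)b=hb$ for $b\in N$; the wreath product $G\wr H$ is the group $H\ltimes G^N$ acting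 on $N\times M$ by $(h,g)(b,a)=(hb,g(b)a)$; and $G$ is a finite index supergroup of $H$ if $M=N$, $H\le G$ and $[G:H]<\infty$. \textbf{Proposition.} Let $G\curvearrowright M$ and $H\curvearrowright N$ be oligomorphic permutation groups. Then $G\times H$ and $G\wr H$ are again oligomorphic permutation groups, and: \begin{itemize} \item If $G$ and $H$ have approximable random endomorphisms, then so do $G\times H$ and $G\wr H$. \item If $G$ is a finite index supergroup of $H$ and $H$ has approximable random endomorphisms, then so does $G$. \item If $G$ has approximable random endomorphisms and $G\simeq H$ as topological groups, then $H$ has approximable random endomorphisms. \end{itemize} -/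

import Mathlib

open FirstOrder MeasureTheory
open scoped unitInterval

universe u v

/-! ### Random variables over `Ω = [0,1]` and `Ω² = [0,1]²` -/

/-- `f : S → X` is a random variable with values in the set `X`, seen as a discrete space. -/
def IsRandomVariable {S : Type*} [MeasurableSpace S] {X : Type*} (f : S → X) : Prop :=
  @Measurable S X _ ⊤ f

/-- The distance `d(f, f') = μ⟦f ≠ f'⟧` of two random variables on `Ω² = I × I` with values in a
discrete space. -/
noncomputable def randomDist {X : Type*} (f f' : I × I → X) : ℝ :=
  (volume : Measure (I × I)).real {x | f x ≠ f' x}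

/-- A countable first-order structure `M` has approximable random endomorphisms: for every random
endomorphism `h ∈ End(M)^{Ω²}` (`End(M)` being the elementary self-embeddings) and `ε > 0` there is
a random automorphism `g ∈ Aut(M)^{Ω²}` with `d(g(f), h(f)) < ε` for all `f ∈ M^Ω`, where `M^Ω` is
seen inside `M^{Ω²}` as the random variables that depend on the first coordinate only.

For countable `M`, Borel measurability of a map into `End(M)` or `Aut(M)`, with the topology of
pointwise convergence on the discrete set `M`, is measurability of all its evaluations at points
of `M`. Elements of `Z^{Ω²}` are given by representatives; the condition does not depend on them. -/
def HasApproximableRandomEndomorphisms (L : FirstOrder.Language) (M : Type*) [L.Structure M] : Prop :=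
  ∀ h : I × I → (M ↪ₑ[L] M), (∀ a : M, IsRandomVariable fun x => h x a) →
    ∀ ε : ℝ, 0 < ε →
      ∃ g : I × I → (M ≃[L] M), (∀ a : M, IsRandomVariable fun x => g x a) ∧
        ∀ f : I → M, IsRandomVariable f →
          randomDist (fun x => g x (f x.1)) (fun x => h x (f x.1)) < ε

/-! ### Permutation groups -/

/-- The topology of pointwise convergence on `Sym(X)`, for the discrete set `X`. -/
instance permPointwiseTopology (X : Type*) : TopologicalSpace (Equiv.Perm X) :=
  TopologicalSpace.induced (fun (g : Equiv.Perm X) => (g : X → X))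
    (@Pi.topologicalSpace X (fun _ => X) fun _ => ⊥)

/-- `G` is an oligomorphic permutation group on the (countable) set `X`: a closed subgroup of
`Sym(X)` that has finitely many orbits on `Xⁿ` for every `n`. -/
structure IsOligomorphicPermGroup {X : Type*} (G : Subgroup (Equiv.Perm X)) : Prop where
  isClosed : IsClosed (G : Set (Equiv.Perm X))
  finite_orbits : ∀ n : ℕ, Finite (MulAction.orbitRel.Quotient G (Fin n → X))

/-- The language of the canonical structure of a permutation group `G` on `X`: an `n`-ary relation
symbol for each orbit of `G` on `Xⁿ`. -/
def permLanguage {X : Type u} (G : Subgroup (Equiv.Perm X)) : FirstOrder.Language.{0, u} where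
  Functions := fun _ => Empty
  Relations := fun n => MulAction.orbitRel.Quotient G (Fin n → X)

/-- The canonical structure of a permutation group `G` on `X`. Its automorphism group is `G` when
`G` is closed (`permStructure_aut_iff`) and its endomorphism semigroup is the left-completion of
`G`, that is, the closure of `G` in `X → X` (`permStructure_endo_iff`). -/
instance permStructure {X : Type u} (G : Subgroup (Equiv.Perm X)) :
    (permLanguage G).Structure X where
  funMap := fun f _ => Empty.elim f
  RelMap := fun r v => Quotient.mk (MulAction.orbitRel G _) v = r

/-- A permutation group has approximable random endomorphisms if its canonical structure has. -/
def PermGroupHasARE {X : Type u} (G : Subgroup (Equiv.Perm X)) : Prop :=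
  HasApproximableRandomEndomorphisms (permLanguage G) X

/-- The direct product `G × H`, acting on the disjoint union `M ⊔ N`. -/
def permDirectProduct {M : Type u} {N : Type v} (G : Subgroup (Equiv.Perm M))
    (H : Subgroup (Equiv.Perm N)) : Subgroup (Equiv.Perm (M ⊕ N)) :=
  (G.prod H).map (Equiv.Perm.sumCongrHom M N)

/-- The wreath product `G ≀ H`, acting on `N × M` by `(h, g)(b, a) = (h b, g(b) a)`, where `h ∈ H`
and `g ∈ G^N`. -/
def permWreathProduct {M : Type u} {N : Type v} (G : Subgroup (Equiv.Perm M))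
    (H : Subgroup (Equiv.Perm N)) : Subgroup (Equiv.Perm (N × M)) where
  carrier := {k | ∃ h ∈ H, ∃ g : N → Equiv.Perm M, (∀ b, g b ∈ G) ∧ k = Equiv.prodShear h g}
  one_mem' := ⟨1, H.one_mem, fun _ => 1, fun _ => G.one_mem, by ext <;> rfl⟩
  mul_mem' := by
    rintro _ _ ⟨h, hh, g, hg, rfl⟩ ⟨h', hh', g', hg', rfl⟩
    exact ⟨h * h', H.mul_mem hh hh', fun b => g (h' b) * g' b,
      fun b => G.mul_mem (hg _) (hg' _), by ext <;> rfl⟩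
  inv_mem' := by
    rintro _ ⟨h, hh, g, hg, rfl⟩
    exact ⟨h⁻¹, H.inv_mem hh, fun b => (g (h⁻¹ b))⁻¹, fun b => G.inv_mem (hg _), by ext <;> rfl⟩

/-! ### Automorphisms and endomorphisms of the canonical structure -/

theorem permStructure_exists_of_relMap {X : Type u} (G : Subgroup (Equiv.Perm X)) {f : X → X}
    (hf : ∀ (n : ℕ) (r : (permLanguage G).Relations n) (v : Fin n → X),
      FirstOrder.Language.Structure.RelMap r v → FirstOrder.Language.Structure.RelMap r (f ∘ v)) (s : Finset X) :
    ∃ g ∈ G, ∀ a ∈ s, g a = f a := by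
  have h := hf s.card (Quotient.mk (MulAction.orbitRel G _) fun i => (s.equivFin.symm i : X))
    (fun i => (s.equivFin.symm i : X)) rfl
  obtain ⟨g, hg⟩ := MulAction.orbitRel_apply.1 (Quotient.exact h)
  refine ⟨g, g.2, fun a ha => ?_⟩
  have h' : g • a = f a := by simpa using congrFun hg (s.equivFin ⟨a, ha⟩)
  exact h'

/-- Every element of `G` is an automorphism of the canonical structure. -/
def permStructureAut {X : Type u} (G : Subgroup (Equiv.Perm X)) (g : G) :
    X ≃[permLanguage G] X where
  toEquiv := g.1
  map_fun' := fun f _ => Empty.elim f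
  map_rel' := fun {n} r v => by
    have : Quotient.mk (MulAction.orbitRel G _) ((g.1 : X → X) ∘ v) =
        Quotient.mk (MulAction.orbitRel G (Fin n → X)) v :=
      Quotient.sound (MulAction.orbitRel_apply.2 ⟨g, rfl⟩)
    change Quotient.mk (MulAction.orbitRel G _) ((g.1 : X → X) ∘ v) = r ↔
      Quotient.mk (MulAction.orbitRel G _) v = r
    rw [this]

theorem permStructure_endo_iff {X : Type u} (G : Subgroup (Equiv.Perm X)) (f : X → X) :
    (∃ h : X ↪ₑ[permLanguage G] X, ⇑h = f) ↔ ∀ s : Finset X, ∃ g ∈ G, ∀ a ∈ s, g a = f a := by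
  constructor
  · rintro ⟨h, rfl⟩
    exact permStructure_exists_of_relMap G fun n r v hv => (h.map_rel r v).2 hv
  · intro hf
    refine ⟨⟨f, fun n φ v => ?_⟩, rfl⟩
    classical
    obtain ⟨g, hg, hgf⟩ := hf (Finset.univ.image v)
    have : f ∘ v = permStructureAut G ⟨g, hg⟩ ∘ v :=
      funext fun i => (hgf _ (Finset.mem_image_of_mem v (Finset.mem_univ i))).symm
    rw [this]
    exact FirstOrder.Language.StrongHomClass.realize_formula (permStructureAut G ⟨g, hg⟩) φ

theorem mem_of_isClosed_perm {X : Type u} {G : Subgroup (Equiv.Perm X)}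
    (hG : IsClosed (G : Set (Equiv.Perm X))) {e : Equiv.Perm X}
    (he : ∀ s : Finset X, ∃ g ∈ G, ∀ a ∈ s, g a = e a) : e ∈ G := by
  let _ : TopologicalSpace X := ⊥
  have : DiscreteTopology X := ⟨rfl⟩
  have hind : Topology.IsInducing (fun g : Equiv.Perm X => (g : X → X)) := ⟨rfl⟩
  rw [← SetLike.mem_coe, ← hG.closure_eq, hind.closure_eq_preimage_closure_image,
    Set.mem_preimage, mem_closure_iff]
  intro o ho heo
  obtain ⟨s, u, hu, hsub⟩ := isOpen_pi_iff.1 ho _ heo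
  obtain ⟨g, hg, hge⟩ := he s
  exact ⟨g, hsub fun a ha => by simpa [hge a ha] using (hu a ha).2, g, hg, rfl⟩

theorem permStructure_aut_iff {X : Type u} {G : Subgroup (Equiv.Perm X)}
    (hG : IsClosed (G : Set (Equiv.Perm X))) (e : Equiv.Perm X) :
    (∃ g : X ≃[permLanguage G] X, ⇑g = ⇑e) ↔ e ∈ G := by
  constructor
  · rintro ⟨g, hg⟩
    refine mem_of_isClosed_perm hG fun s => ?_
    rw [← hg]
    exact permStructure_exists_of_relMap G (fun n r v hv => (g.map_rel r v).2 hv) s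
  · intro he
    exact ⟨permStructureAut G ⟨e, he⟩, rfl⟩

/-- For closed `G`, the property in terms of `G` and its left-completion. -/
theorem permGroupHasARE_iff {X : Type u} {G : Subgroup (Equiv.Perm X)}
    (hG : IsClosed (G : Set (Equiv.Perm X))) :
    PermGroupHasARE G ↔
      ∀ h : I × I → X → X, (∀ x, ∀ s : Finset X, ∃ g ∈ G, ∀ a ∈ s, g a = h x a) →
        (∀ a, IsRandomVariable fun x => h x a) → ∀ ε : ℝ, 0 < ε →
        ∃ g : I × I → Equiv.Perm X, (∀ x, g x ∈ G) ∧ (∀ a, IsRandomVariable fun x => g x a) ∧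
          ∀ f : I → X, IsRandomVariable f →
            randomDist (fun x => g x (f x.1)) (fun x => h x (f x.1)) < ε := by
  constructor
  · intro H h hh hm ε hε
    choose k hk using fun x => (permStructure_endo_iff G (h x)).2 (hh x)
    obtain ⟨g, hg, hd⟩ := H k (fun a => by simpa only [hk] using hm a) ε hε
    refine ⟨fun x => (g x).toEquiv, fun x => (permStructure_aut_iff hG _).1 ⟨g x, rfl⟩, hg,
      fun f hf => ?_⟩
    have := hd f hf
    simp only [hk] at this
    exact this
  · intro H h hm ε hε
    obtain ⟨g, hgG, hg, hd⟩ :=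
      H (fun x => h x) (fun x => (permStructure_endo_iff G (h x)).1 ⟨h x, rfl⟩) hm ε hε
    exact ⟨fun x => permStructureAut G ⟨g x, hgG x⟩, hg, hd⟩

/-! For closed `G` the property concerns random elements of the left-completion, the maps that agree
with an element of `G` on every finite set. Each case decomposes or transports such a map,
approximates the pieces and adds up the errors by a union bound.

Products: an element of the completion splits into a pair (`exists_sum`) or into a map `h` of `N`
with a family `g b` on `M` (`exists_shear`). A random point meets only some pieces, so they are
tested on partially defined variables; in the wreath product the errors of the `g b` form a
convergent series.

Finite index: the completion of `G` is a finite union of translates of that of `K`, so `h ∘ r` lies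
in the latter for a measurably chosen representative `r` (`exists_comp_of_transversal`). Approximate
`h ∘ r` by `g` and use `g * r⁻¹`.

Isomorphism `φ`: by continuity `φ.symm` extends to the completions. If `g` approximates the image of
`h`, then `φ g` approximates `h`: the value of `φ g` at `b` depends on `g` at finitely many points,
and their number is bounded uniformly in `b` because `H` has finitely many orbits on `N`
(`exists_uniform_support`). -/

open scoped ENNReal

/-! ### Random variables with values in countable sets -/

section RandomVariables

variable {S : Type*} [MeasurableSpace S] {X Y : Type*}

theorem IsRandomVariable.comp {f : S → X} (hf : IsRandomVariable f) (g : X → Y) :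
    IsRandomVariable fun x => g (f x) := by
  unfold IsRandomVariable at hf ⊢
  exact (@measurable_from_top X Y ⊤ g).comp hf

theorem isRandomVariable_of_fiber [Countable X] {f : S → X}
    (h : ∀ a, MeasurableSet {x | f x = a}) : IsRandomVariable f := by
  let _ : MeasurableSpace X := ⊤
  exact measurable_to_countable' h

theorem IsRandomVariable.measurableSet {f : S → X} (hf : IsRandomVariable f) (p : X → Prop) :
    MeasurableSet {x | p (f x)} :=
  hf (t := {a | p a}) trivial

/-- A random function on a countable set, evaluated at a random point. -/
theorem IsRandomVariable.eval [Countable X] {F : S → X → Y}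
    (hF : ∀ a, IsRandomVariable fun x => F x a) {p : S → X} (hp : IsRandomVariable p) :
    IsRandomVariable fun x => F x (p x) := by
  intro s _
  have : (fun x => F x (p x)) ⁻¹' s = ⋃ a, {x | p x = a} ∩ {x | F x a ∈ s} := by
    ext x; simp
  rw [this]
  exact MeasurableSet.iUnion fun a =>
    (hp.measurableSet (· = a)).inter ((hF a).measurableSet (· ∈ s))

theorem isRandomVariable_restrict [Countable X] {F : S → X → X}
    (hF : ∀ a, IsRandomVariable fun x => F x a) (T : Finset X) :
    IsRandomVariable fun x => fun a : T => F x a := by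
  refine isRandomVariable_of_fiber fun r => ?_
  have : {x | (fun a : T => F x a) = r} = ⋂ a : T, {x | F x a = r a} := by
    ext x; simp [funext_iff]
  rw [this]
  exact MeasurableSet.iInter fun a => (hF a).measurableSet (· = r a)

/-- A quantity that is determined by the values of a random function on a finite set is a random
variable. -/
theorem isRandomVariable_of_finset [Countable X] {F : S → X → X}
    (hF : ∀ a, IsRandomVariable fun x => F x a) (T : Finset X) {f : S → Y}
    (hf : ∀ x y, (∀ a ∈ T, F x a = F y a) → f x = f y) : IsRandomVariable f := by
  intro s _
  have : f ⁻¹' s = {x | ∃ y, f y ∈ s ∧ (fun a : T => F y a) = fun a : T => F x a} := by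
    ext x
    constructor
    · exact fun hx => ⟨x, hx, rfl⟩
    · rintro ⟨y, hy, h⟩
      have := hf y x fun a ha => congrFun h ⟨a, ha⟩
      simpa [this] using hy
  rw [this]
  exact (isRandomVariable_restrict hF T).measurableSet fun r =>
    ∃ y, f y ∈ s ∧ (fun a : T => F y a) = r

/-- Take the admissible index with the least code under an injection into `ℕ`. -/
theorem exists_isRandomVariable_selection {ι : Type*} [Countable ι] {p : S → ι → Prop}
    (hp : ∀ x, ∃ i, p x i) (hm : ∀ i, MeasurableSet {x | p x i}) :
    ∃ f : S → ι, IsRandomVariable f ∧ ∀ x, p x (f x) := by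
  classical
  obtain ⟨e, he⟩ := exists_injective_nat ι
  have hq : ∀ x, ∃ n, ∃ i, e i = n ∧ p x i := fun x => by
    obtain ⟨i, hi⟩ := hp x
    exact ⟨_, i, rfl, hi⟩
  have hfind := measurable_find hq fun n => by
    have : {x | ∃ i, e i = n ∧ p x i} = ⋃ i, ⋃ _ : e i = n, {x | p x i} := by ext x; simp
    rw [this]
    exact MeasurableSet.iUnion fun i => MeasurableSet.iUnion fun _ => hm i
  choose f hf hpf using fun x => Nat.find_spec (hq x)
  refine ⟨f, isRandomVariable_of_fiber fun i => ?_, hpf⟩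
  have : {x | f x = i} = (fun x => Nat.find (hq x)) ⁻¹' {e i} := by
    ext x
    simp only [Set.mem_ofPred_eq, Set.mem_preimage, Set.mem_singleton_iff, ← hf x, he.eq_iff]
  rw [this]
  exact hfind (measurableSet_singleton _)

end RandomVariables

/-! ### The left-completion of a permutation group -/

/-- `f` belongs to the closure of `G` in `X → X`. -/
def InLeftCompletion {X : Type*} (G : Subgroup (Equiv.Perm X)) (f : X → X) : Prop :=
  ∀ s : Finset X, ∃ g ∈ G, ∀ a ∈ s, g a = f a

/-- Converse of `mem_of_isClosed_perm`: closedness can be checked by finite approximation. -/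
theorem isClosed_perm_of_forall {X : Type*} {G : Subgroup (Equiv.Perm X)}
    (h : ∀ e : Equiv.Perm X, InLeftCompletion G e → e ∈ G) :
    IsClosed (G : Set (Equiv.Perm X)) := by
  classical
  refine isClosed_of_closure_subset fun e he => h e fun s => ?_
  let _ : TopologicalSpace X := ⊥
  have : DiscreteTopology X := ⟨rfl⟩
  have hcont : Continuous (fun g : Equiv.Perm X => (g : X → X)) := continuous_induced_dom
  have hopen : IsOpen {g : Equiv.Perm X | ∀ a ∈ s, g a = e a} := by
    have : {g : Equiv.Perm X | ∀ a ∈ s, g a = e a} = ⋂ a ∈ s, {g : Equiv.Perm X | g a = e a} := by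
      ext; simp
    rw [this]
    exact isOpen_biInter_finset fun a _ =>
      (isOpen_discrete {e a}).preimage ((continuous_apply a).comp hcont)
  obtain ⟨g, hg, hgG⟩ := mem_closure_iff.1 he _ hopen fun _ _ => rfl
  exact ⟨g, hgG, hg⟩

theorem InLeftCompletion.injective {X : Type*} {G : Subgroup (Equiv.Perm X)} {f : X → X}
    (hf : InLeftCompletion G f) : Function.Injective f := by
  classical
  intro a b hab
  obtain ⟨g, -, hg⟩ := hf {a, b}
  exact g.injective (by rw [hg a (by simp), hg b (by simp), hab])

/-- There are countably many finite sets, and each imposes a condition on finitely many values only.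
-/
theorem measurableSet_inLeftCompletion {S : Type*} [MeasurableSpace S] {X : Type*} [Countable X]
    {F : S → X → X} (hF : ∀ a, IsRandomVariable fun x => F x a) (G : Subgroup (Equiv.Perm X)) :
    MeasurableSet {x | InLeftCompletion G (F x)} := by
  have : {x | InLeftCompletion G (F x)} =
      ⋂ s : Finset X, {x | ∃ g ∈ G, (fun a : s => g a) = fun a : s => F x a} := by
    ext x
    simp [InLeftCompletion, funext_iff]
  rw [this]
  exact MeasurableSet.iInter fun s =>
    (isRandomVariable_restrict hF s).measurableSet fun r => ∃ g ∈ G, (fun a : s => g a) = r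

/-! ### Approximable random endomorphisms in terms of the left-completion -/

theorem randomDist_lt_iff {X : Type*} {f f' : I × I → X} {ε : ℝ} :
    randomDist f f' < ε ↔
      (volume : Measure (I × I)) {x | f x ≠ f' x} < ENNReal.ofReal ε := by
  rw [randomDist, measureReal_def, ← ENNReal.lt_ofReal_iff_toReal_lt (measure_ne_top _ _)]

/-- Approximation of random elements of the left-completion, tested on partially defined random
variables. -/
theorem PermGroupHasARE.exists_partial {X : Type u} {G : Subgroup (Equiv.Perm X)}
    (hG : IsClosed (G : Set (Equiv.Perm X))) (hA : PermGroupHasARE G) {h : I × I → X → X}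
    (hh : ∀ x, InLeftCompletion G (h x)) (hm : ∀ a, IsRandomVariable fun x => h x a)
    {ε : ℝ≥0∞} (hε : 0 < ε) :
    ∃ g : I × I → Equiv.Perm X, (∀ x, g x ∈ G) ∧ (∀ a, IsRandomVariable fun x => g x a) ∧
      ∀ f : I → Option X, IsRandomVariable f →
        (volume : Measure (I × I)) {x | ∃ a ∈ f x.1, g x a ≠ h x a} < ε := by
  obtain ⟨δ, -, hδ, hδε⟩ := ENNReal.lt_iff_exists_real_btwn.1 hε
  have hδ' : 0 < δ := ENNReal.ofReal_pos.1 hδ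
  obtain ⟨g, hgG, hg, hd⟩ := (permGroupHasARE_iff hG).1 hA h hh hm δ hδ'
  refine ⟨g, hgG, hg, fun f hf => ?_⟩
  rcases isEmpty_or_nonempty X with hX | ⟨⟨a₀⟩⟩
  · have : {x : I × I | ∃ a ∈ f x.1, g x a ≠ h x a} = ∅ := by
      ext x; simp
    rw [this, measure_empty]
    exact hε
  · have := randomDist_lt_iff.1 (hd (fun t => (f t).getD a₀) (hf.comp (·.getD a₀)))
    refine lt_of_le_of_lt (measure_mono ?_) (this.trans hδε)
    rintro x ⟨a, ha, hne⟩
    simpa [Option.mem_def.1 ha] using hne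

theorem permGroupHasARE_of_forall {X : Type u} {G : Subgroup (Equiv.Perm X)}
    (hG : IsClosed (G : Set (Equiv.Perm X)))
    (hA : ∀ h : I × I → X → X, (∀ x, InLeftCompletion G (h x)) →
      (∀ a, IsRandomVariable fun x => h x a) → ∀ ε : ℝ≥0∞, 0 < ε →
      ∃ g : I × I → Equiv.Perm X, (∀ x, g x ∈ G) ∧ (∀ a, IsRandomVariable fun x => g x a) ∧
        ∀ f : I → X, IsRandomVariable f →
          (volume : Measure (I × I)) {x | g x (f x.1) ≠ h x (f x.1)} < ε) :
    PermGroupHasARE G := by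
  refine (permGroupHasARE_iff hG).2 fun h hh hm ε hε => ?_
  obtain ⟨g, hgG, hg, hd⟩ := hA h hh hm _ (ENNReal.ofReal_pos.2 hε)
  exact ⟨g, hgG, hg, fun f hf => randomDist_lt_iff.2 (hd f hf)⟩

theorem PermGroupHasARE.exists_total {X : Type u} {G : Subgroup (Equiv.Perm X)}
    (hG : IsClosed (G : Set (Equiv.Perm X))) (hA : PermGroupHasARE G) {h : I × I → X → X}
    (hh : ∀ x, InLeftCompletion G (h x)) (hm : ∀ a, IsRandomVariable fun x => h x a)
    {ε : ℝ≥0∞} (hε : 0 < ε) :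
    ∃ g : I × I → Equiv.Perm X, (∀ x, g x ∈ G) ∧ (∀ a, IsRandomVariable fun x => g x a) ∧
      ∀ f : I → X, IsRandomVariable f →
        (volume : Measure (I × I)) {x | g x (f x.1) ≠ h x (f x.1)} < ε := by
  obtain ⟨g, hgG, hg, hd⟩ := hA.exists_partial hG hh hm hε
  refine ⟨g, hgG, hg, fun f hf => ?_⟩
  simpa using hd (fun t => some (f t)) (hf.comp some)

/-! ### Oligomorphic groups move small sets into a fixed finite set -/

/-- `F` collects the entries of one representative tuple per orbit. With the converse below, this
turns orbit counting into a condition that passes to products. -/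
theorem exists_finset_of_finite_orbits {X : Type*} {G : Subgroup (Equiv.Perm X)} {n : ℕ}
    (h : Finite (MulAction.orbitRel.Quotient G (Fin n → X))) :
    ∃ F : Finset X, ∀ s : Finset X, s.card ≤ n → ∃ g ∈ G, ∀ a ∈ s, g a ∈ F := by
  classical
  have hfin : (⋃ q : MulAction.orbitRel.Quotient G (Fin n → X), Set.range q.out).Finite :=
    Set.finite_iUnion fun q => Set.finite_range _
  refine ⟨hfin.toFinset, fun s hs => ?_⟩
  rcases s.eq_empty_or_nonempty with rfl | ⟨a₀, ha₀⟩
  · exact ⟨1, G.one_mem, by simp⟩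
  -- Sets with fewer than `n` elements are padded by repeating `a₀`.
  let v : Fin n → X := fun i =>
    if hi : (i : ℕ) < s.card then s.equivFin.symm ⟨i, hi⟩ else a₀
  have hv : ∀ a ∈ s, ∃ i, v i = a := fun a ha => by
    refine ⟨Fin.castLE hs (s.equivFin ⟨a, ha⟩), ?_⟩
    simp [v]
  let q : MulAction.orbitRel.Quotient G (Fin n → X) := Quotient.mk (MulAction.orbitRel G _) v
  obtain ⟨g, hg⟩ := MulAction.orbitRel_apply.1 (Quotient.exact (Quotient.out_eq q))
  refine ⟨g.1, g.2, fun a ha => ?_⟩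
  obtain ⟨i, rfl⟩ := hv a ha
  rw [Set.Finite.mem_toFinset, Set.mem_iUnion]
  exact ⟨q, i, (congrFun hg i).symm⟩

theorem finite_orbits_of_finset {X : Type*} {G : Subgroup (Equiv.Perm X)} {n : ℕ}
    (h : ∃ F : Finset X, ∀ s : Finset X, s.card ≤ n → ∃ g ∈ G, ∀ a ∈ s, g a ∈ F) :
    Finite (MulAction.orbitRel.Quotient G (Fin n → X)) := by
  classical
  obtain ⟨F, hF⟩ := h
  refine Finite.of_surjective (α := Fin n → F)
    (fun w => Quotient.mk (MulAction.orbitRel G _) fun i => (w i : X)) fun q => ?_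
  obtain ⟨v, rfl⟩ := Quotient.exists_rep q
  obtain ⟨g, hg, hgF⟩ := hF (Finset.univ.image v)
    (Finset.card_image_le.trans (by simp))
  refine ⟨fun i => ⟨g (v i), hgF _ (by simp)⟩, Quotient.sound ?_⟩
  exact MulAction.orbitRel_apply.2 ⟨⟨g, hg⟩, rfl⟩

/-! ### Direct products -/

section DirectProduct

variable {M : Type u} {N : Type v} {G : Subgroup (Equiv.Perm M)} {H : Subgroup (Equiv.Perm N)}

theorem mem_permDirectProduct {k : Equiv.Perm (M ⊕ N)} :
    k ∈ permDirectProduct G H ↔ ∃ g ∈ G, ∃ h ∈ H, Equiv.sumCongr g h = k := by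
  constructor
  · rintro ⟨⟨g, h⟩, ⟨hg, hh⟩, rfl⟩
    exact ⟨g, hg, h, hh, rfl⟩
  · rintro ⟨g, hg, h, hh, rfl⟩
    exact ⟨(g, h), ⟨hg, hh⟩, rfl⟩

/-- Elements of the left-completion of `G × H` are sums of elements of the left-completions. -/
theorem InLeftCompletion.exists_sum {k : M ⊕ N → M ⊕ N}
    (hk : InLeftCompletion (permDirectProduct G H) k) :
    ∃ g : M → M, ∃ h : N → N, InLeftCompletion G g ∧ InLeftCompletion H h ∧ k = Sum.map g h := by
  classical
  have h1 : ∀ a, ∃ a', k (Sum.inl a) = Sum.inl a' := fun a => by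
    obtain ⟨e, he, hek⟩ := hk {Sum.inl a}
    obtain ⟨g, -, h, -, rfl⟩ := mem_permDirectProduct.1 he
    exact ⟨g a, (hek _ (by simp)).symm⟩
  have h2 : ∀ b, ∃ b', k (Sum.inr b) = Sum.inr b' := fun b => by
    obtain ⟨e, he, hek⟩ := hk {Sum.inr b}
    obtain ⟨g, -, h, -, rfl⟩ := mem_permDirectProduct.1 he
    exact ⟨h b, (hek _ (by simp)).symm⟩
  choose g hg using h1
  choose h hh using h2
  refine ⟨g, h, fun s => ?_, fun s => ?_, funext ?_⟩
  · obtain ⟨e, he, hek⟩ := hk (s.image Sum.inl)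
    obtain ⟨g', hg', h', -, rfl⟩ := mem_permDirectProduct.1 he
    refine ⟨g', hg', fun a ha => Sum.inl_injective (β := N) ?_⟩
    rw [← hg, ← hek _ (Finset.mem_image_of_mem _ ha)]
    rfl
  · obtain ⟨e, he, hek⟩ := hk (s.image Sum.inr)
    obtain ⟨g', -, h', hh', rfl⟩ := mem_permDirectProduct.1 he
    refine ⟨h', hh', fun a ha => Sum.inr_injective (α := M) ?_⟩
    rw [← hh, ← hek _ (Finset.mem_image_of_mem _ ha)]
    rfl
  · rintro (a | b)
    · exact hg a
    · exact hh b

theorem IsOligomorphicPermGroup.directProduct (hG : IsOligomorphicPermGroup G)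
    (hH : IsOligomorphicPermGroup H) : IsOligomorphicPermGroup (permDirectProduct G H) := by
  classical
  constructor
  · refine isClosed_perm_of_forall fun e he => ?_
    obtain ⟨g, h, hg, hh, hgh⟩ := he.exists_sum
    have hbij : Function.Bijective (Sum.map g h) := hgh ▸ e.bijective
    rw [Sum.map_bijective] at hbij
    refine mem_permDirectProduct.2 ⟨Equiv.ofBijective g hbij.1,
      mem_of_isClosed_perm hG.isClosed hg, Equiv.ofBijective h hbij.2,
      mem_of_isClosed_perm hH.isClosed hh, Equiv.ext fun x => ?_⟩
    rw [hgh]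
    rfl
  · intro n
    obtain ⟨F, hF⟩ := exists_finset_of_finite_orbits (hG.finite_orbits n)
    obtain ⟨F', hF'⟩ := exists_finset_of_finite_orbits (hH.finite_orbits n)
    refine finite_orbits_of_finset ⟨F.disjSum F', fun s hs => ?_⟩
    have hcard := s.card_toLeft_add_card_toRight
    obtain ⟨g, hg, hgF⟩ := hF s.toLeft (by omega)
    obtain ⟨h, hh, hhF⟩ := hF' s.toRight (by omega)
    refine ⟨_, mem_permDirectProduct.2 ⟨g, hg, h, hh, rfl⟩, ?_⟩
    rintro (a | b) ha
    · exact Finset.inl_mem_disjSum.2 (hgF a (Finset.mem_toLeft.2 ha))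
    · exact Finset.inr_mem_disjSum.2 (hhF b (Finset.mem_toRight.2 ha))

theorem PermGroupHasARE.directProduct (hG : IsOligomorphicPermGroup G)
    (hH : IsOligomorphicPermGroup H) (hAG : PermGroupHasARE G) (hAH : PermGroupHasARE H) :
    PermGroupHasARE (permDirectProduct G H) := by
  refine permGroupHasARE_of_forall (hG.directProduct hH).isClosed fun k hk hm ε hε => ?_
  choose g h hg hh hgh using fun x => (hk x).exists_sum
  have hε2 : 0 < ε / 2 := ENNReal.half_pos hε.ne'
  obtain ⟨g', hg'G, hg'm, hg'⟩ := hAG.exists_partial hG.isClosed hg (fun a => by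
    have := (hm (Sum.inl a)).comp fun y => y.elim id fun _ => a
    simpa [hgh] using this) hε2
  obtain ⟨h', hh'H, hh'm, hh'⟩ := hAH.exists_partial hH.isClosed hh (fun a => by
    have := (hm (Sum.inr a)).comp fun y => y.elim (fun _ => a) id
    simpa [hgh] using this) hε2
  refine ⟨fun x => Equiv.sumCongr (g' x) (h' x),
    fun x => mem_permDirectProduct.2 ⟨_, hg'G x, _, hh'H x, rfl⟩, ?_, fun f hf => ?_⟩
  · rintro (a | b)
    · exact (hg'm a).comp Sum.inl
    · exact (hh'm b).comp Sum.inr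
  -- `getLeft?` and `getRight?` cut `f` into its partially defined parts in `M` and `N`.
  · refine lt_of_le_of_lt ((measure_mono ?_).trans (measure_union_le _ _))
      ((ENNReal.add_lt_add (hg' _ (hf.comp Sum.getLeft?)) (hh' _ (hf.comp Sum.getRight?))).trans_eq
        (ENNReal.add_halves ε))
    intro x hx
    simp only [Set.mem_ofPred_eq, hgh] at hx
    rcases hfx : f x.1 with a | b
    · refine Or.inl ⟨a, by simp [hfx], fun h => hx ?_⟩
      simp [hfx, h]
    · refine Or.inr ⟨b, by simp [hfx], fun h => hx ?_⟩
      simp [hfx, h]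

end DirectProduct

/-! ### Wreath products -/

section WreathProduct

variable {M : Type u} {N : Type v} {G : Subgroup (Equiv.Perm M)} {H : Subgroup (Equiv.Perm N)}

theorem mem_permWreathProduct {k : Equiv.Perm (N × M)} :
    k ∈ permWreathProduct G H ↔
      ∃ h ∈ H, ∃ g : N → Equiv.Perm M, (∀ b, g b ∈ G) ∧ k = Equiv.prodShear h g :=
  Iff.rfl

/-- Elements of the left-completion of `G ≀ H` are sheared products of elements of the
left-completions. -/
theorem InLeftCompletion.exists_shear [Nonempty M] {k : N × M → N × M}
    (hk : InLeftCompletion (permWreathProduct G H) k) :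
    ∃ h : N → N, ∃ g : N → M → M, InLeftCompletion H h ∧ (∀ b, InLeftCompletion G (g b)) ∧
      ∀ b a, k (b, a) = (h b, g b a) := by
  classical
  -- A base point to read off the action on `N`; approximating at `(b, a)` and `(b, a₀)` together
  -- shows that the first coordinate does not depend on `a`.
  let a₀ : M := Classical.arbitrary M
  refine ⟨fun b => (k (b, a₀)).1, fun b a => (k (b, a)).2, fun s => ?_, fun b s => ?_,
    fun b a => ?_⟩
  · obtain ⟨e, ⟨h, hh, g, hg, rfl⟩, hek⟩ := hk (s ×ˢ {a₀})
    refine ⟨h, hh, fun b hb => ?_⟩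
    exact congrArg Prod.fst (hek (b, a₀) (by simp [hb]))
  · obtain ⟨e, ⟨h, hh, g, hg, rfl⟩, hek⟩ := hk ({b} ×ˢ s)
    refine ⟨g b, hg b, fun a ha => ?_⟩
    exact congrArg Prod.snd (hek (b, a) (by simp [ha]))
  · obtain ⟨e, ⟨h, hh, g, hg, rfl⟩, hek⟩ := hk {(b, a), (b, a₀)}
    have h1 := congrArg Prod.fst (hek (b, a) (by simp))
    have h2 := congrArg Prod.fst (hek (b, a₀) (by simp))
    exact Prod.ext (h1.symm.trans h2) rfl

theorem IsOligomorphicPermGroup.wreathProduct (hG : IsOligomorphicPermGroup G)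
    (hH : IsOligomorphicPermGroup H) : IsOligomorphicPermGroup (permWreathProduct G H) := by
  classical
  constructor
  · refine isClosed_perm_of_forall fun e he => ?_
    rcases isEmpty_or_nonempty M with hM | hM
    · exact Subsingleton.elim 1 e ▸ Subgroup.one_mem _
    obtain ⟨h, g, hh, hg, hgh⟩ := he.exists_shear
    have a₀ : M := Classical.arbitrary M
    have hhb : Function.Bijective h := by
      refine ⟨hh.injective, fun b => ?_⟩
      obtain ⟨⟨b', a⟩, hb'⟩ := e.surjective (b, a₀)
      exact ⟨b', congrArg Prod.fst ((hgh b' a).symm.trans hb')⟩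
    have hgb : ∀ b, Function.Bijective (g b) := fun b => by
      refine ⟨(hg b).injective, fun a => ?_⟩
      obtain ⟨⟨b', a'⟩, hb'⟩ := e.surjective (h b, a)
      rw [hgh, Prod.mk.injEq] at hb'
      exact ⟨a', hhb.1 hb'.1 ▸ hb'.2⟩
    refine mem_permWreathProduct.2 ⟨Equiv.ofBijective h hhb, mem_of_isClosed_perm hH.isClosed hh,
      fun b => Equiv.ofBijective (g b) (hgb b),
      fun b => mem_of_isClosed_perm hG.isClosed (hg b), Equiv.ext fun x => ?_⟩
    exact hgh x.1 x.2
  · intro n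
    obtain ⟨F, hF⟩ := exists_finset_of_finite_orbits (hG.finite_orbits n)
    obtain ⟨F', hF'⟩ := exists_finset_of_finite_orbits (hH.finite_orbits n)
    refine finite_orbits_of_finset ⟨F' ×ˢ F, fun s hs => ?_⟩
    obtain ⟨h, hh, hhF⟩ := hF' (s.image Prod.fst) (Finset.card_image_le.trans hs)
    choose g hg hgF using fun b : N => hF ((s.filter (·.1 = b)).image Prod.snd)
      (Finset.card_image_le.trans ((Finset.card_filter_le _ _).trans hs))
    refine ⟨_, mem_permWreathProduct.2 ⟨h, hh, g, hg, rfl⟩, fun x hx => ?_⟩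
    refine Finset.mem_product.2 ⟨hhF _ (Finset.mem_image_of_mem _ hx), hgF _ _ ?_⟩
    exact Finset.mem_image_of_mem _ (Finset.mem_filter.2 ⟨hx, rfl⟩)

theorem PermGroupHasARE.wreathProduct [Countable M] [Countable N] (hG : IsOligomorphicPermGroup G)
    (hH : IsOligomorphicPermGroup H) (hAG : PermGroupHasARE G) (hAH : PermGroupHasARE H) :
    PermGroupHasARE (permWreathProduct G H) := by
  classical
  refine permGroupHasARE_of_forall (hG.wreathProduct hH).isClosed fun k hk hm ε hε => ?_
  rcases isEmpty_or_nonempty M with hM | hM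
  · exact ⟨fun _ => 1, fun _ => Subgroup.one_mem _, fun a => isEmptyElim a.2,
      fun f _ => isEmptyElim (f 0).2⟩
  choose h g hh hg hgh using fun x => (hk x).exists_shear
  have hε2 : 0 < ε / 2 := ENNReal.half_pos hε.ne'
  obtain ⟨δ, hδ, hδε⟩ := ENNReal.exists_pos_sum_of_countable' hε2.ne' N
  obtain ⟨h', hh'H, hh'm, hh'⟩ := hAH.exists_total hH.isClosed hh (fun b => by
    simpa [hgh] using (hm (b, Classical.arbitrary M)).comp Prod.fst) hε2
  choose g' hg'G hg'm hg' using fun b => hAG.exists_partial hG.isClosed (fun x => hg x b)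
    (fun a => by simpa [hgh] using (hm (b, a)).comp Prod.snd) (hδ b)
  refine ⟨fun x => Equiv.prodShear (h' x) fun b => g' b x,
    fun x => mem_permWreathProduct.2 ⟨_, hh'H x, _, fun b => hg'G b x, rfl⟩, ?_, fun f hf => ?_⟩
  · rintro ⟨b, a⟩
    have : IsRandomVariable fun x => (fun a' => (h' x b, a')) (g' b x a) :=
      IsRandomVariable.eval (F := fun x a' => (h' x b, a'))
        (fun a' => (hh'm b).comp fun b' => (b', a')) (hg'm b a)
    exact this
  · let p : N → N × M → Option M := fun b y => if y.1 = b then some y.2 else none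
    have hsub : {x : I × I | Equiv.prodShear (h' x) (fun b => g' b x) (f x.1) ≠ k x (f x.1)} ⊆
        {x | h' x (f x.1).1 ≠ h x (f x.1).1} ∪
          ⋃ b, {x | ∃ a ∈ p b (f x.1), g' b x a ≠ g x b a} := by
      intro x hx
      by_contra hcon
      simp only [Set.mem_union, Set.mem_ofPred_eq, Set.mem_iUnion, not_or, not_exists, not_and,
        not_not] at hcon
      refine hx ?_
      rw [← Prod.mk.eta (p := f x.1), hgh]
      exact Prod.ext hcon.1 (hcon.2 (f x.1).1 (f x.1).2 (by simp [p]))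
    calc _ ≤ _ := (measure_mono hsub).trans (measure_union_le _ _)
      _ ≤ _ + ∑' b, δ b := add_le_add le_rfl ((measure_iUnion_le _).trans
          (ENNReal.tsum_le_tsum fun b => (hg' b _ (hf.comp (p b))).le))
      _ < ε / 2 + ε / 2 := ENNReal.add_lt_add (hh' _ (hf.comp Prod.fst)) hδε
      _ = ε := ENNReal.add_halves ε

end WreathProduct

/-! ### Finite sums of small errors -/

/-- The `+ 1` keeps the bound strict and covers the empty family. -/
theorem measure_biUnion_finset_lt {α ι : Type*} [MeasurableSpace α] (μ : Measure α)
    (s : Finset ι) (A : ι → Set α) {ε : ℝ≥0∞} (hε : 0 < ε) (hε' : ε ≠ ∞)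
    (h : ∀ i ∈ s, μ (A i) < ε / (s.card + 1)) : μ (⋃ i ∈ s, A i) < ε := by
  have hpos : ((s.card : ℝ≥0∞) + 1) ≠ 0 := by simp
  have htop : ((s.card : ℝ≥0∞) + 1) ≠ ∞ := by finiteness
  calc μ (⋃ i ∈ s, A i) ≤ ∑ i ∈ s, μ (A i) := measure_biUnion_finset_le s A
    _ ≤ ∑ _i ∈ s, ε / (s.card + 1) := Finset.sum_le_sum fun i hi => (h i hi).le
    _ = s.card * (ε / (s.card + 1)) := by simp
    _ < (s.card + 1) * (ε / (s.card + 1)) := by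
      have : ε / ((s.card : ℝ≥0∞) + 1) ≠ 0 := (ENNReal.div_pos hε.ne' htop).ne'
      have h3 : ε / ((s.card : ℝ≥0∞) + 1) ≠ ∞ := ENNReal.div_ne_top hε' hpos
      rw [add_mul, one_mul]
      exact ENNReal.lt_add_right (ENNReal.mul_ne_top (by simp) h3) this
    _ = ε := ENNReal.mul_div_cancel hpos htop

/-! ### Finite index supergroups -/

section FiniteIndex

variable {M : Type u} {G K : Subgroup (Equiv.Perm M)}

theorem exists_right_transversal (h : K.IsFiniteRelIndex G) :
    ∃ R : Finset (Equiv.Perm M), (∀ r ∈ R, r ∈ G) ∧ ∀ g ∈ G, ∃ r ∈ R, g * r ∈ K := by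
  classical
  have hfin : Finite (G ⧸ K.subgroupOf G) := by
    have : (K.subgroupOf G).index ≠ 0 := h.relIndex_ne_zero
    exact @Subgroup.finite_quotient_of_finiteIndex _ _ _ ⟨this⟩
  have := Fintype.ofFinite (G ⧸ K.subgroupOf G)
  refine ⟨Finset.univ.image fun q : G ⧸ K.subgroupOf G => (q.out : Equiv.Perm M), ?_, ?_⟩
  · intro r hr
    obtain ⟨q, -, rfl⟩ := Finset.mem_image.1 hr
    exact q.out.2
  · intro g hg
    -- Mathlib's quotient consists of left cosets: a representative `r` of `g⁻¹ K` satisfies `g * r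
    -- ∈ K`.
    refine ⟨_, Finset.mem_image_of_mem _ (Finset.mem_univ (QuotientGroup.mk (⟨g, hg⟩⁻¹ : G))), ?_⟩
    have := QuotientGroup.eq.1 (QuotientGroup.out_eq'
      (QuotientGroup.mk (⟨g, hg⟩⁻¹ : G) : G ⧸ K.subgroupOf G)).symm
    rw [Subgroup.mem_subgroupOf] at this
    simpa using this

/-- If every `r` failed on some finite set `s r`, an element of `G` agreeing with `f` on the union
of the images `r (s r)` would contradict the failure for its own representative. -/
theorem InLeftCompletion.exists_comp_of_transversal {R : Finset (Equiv.Perm M)}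
    (hR : ∀ g ∈ G, ∃ r ∈ R, g * r ∈ K) {f : M → M} (hf : InLeftCompletion G f) :
    ∃ r : R, InLeftCompletion K (f ∘ r.1) := by
  classical
  by_contra! hcon
  have hex : ∀ r : R, ∃ s : Finset M, ∀ g ∈ K, ∃ a ∈ s, g a ≠ f (r.1 a) := fun r => by
    simpa [InLeftCompletion] using hcon r
  choose s hs using hex
  obtain ⟨g, hg, hgf⟩ := hf (Finset.univ.biUnion fun r : R => (s r).image r.1)
  obtain ⟨r, hr, hgr⟩ := hR g hg
  obtain ⟨a, ha, hne⟩ := hs ⟨r, hr⟩ _ hgr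
  refine hne (hgf _ ?_)
  exact Finset.mem_biUnion.2 ⟨⟨r, hr⟩, Finset.mem_univ _, Finset.mem_image_of_mem _ ha⟩

theorem PermGroupHasARE.of_finiteIndex [Countable M] (hG : IsClosed (G : Set (Equiv.Perm M)))
    (hK : IsClosed (K : Set (Equiv.Perm M))) (hKG : K ≤ G) (hfin : K.IsFiniteRelIndex G)
    (hA : PermGroupHasARE K) : PermGroupHasARE G := by
  classical
  obtain ⟨R, hRG, hR⟩ := exists_right_transversal hfin
  refine permGroupHasARE_of_forall hG fun h hh hm ε hε => ?_
  wlog hε' : ε ≠ ∞ generalizing ε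
  · obtain ⟨g, hgG, hgm, hg⟩ := this 1 one_pos ENNReal.one_ne_top
    rw [not_not.1 hε']
    exact ⟨g, hgG, hgm, fun f hf => (hg f hf).trans ENNReal.one_lt_top⟩
  obtain ⟨r, hrm, hr⟩ := exists_isRandomVariable_selection
    (p := fun x (r : R) => InLeftCompletion K (h x ∘ r.1))
    (fun x => (hh x).exists_comp_of_transversal hR)
    fun r => measurableSet_inLeftCompletion (F := fun x => h x ∘ r.1) (fun a => hm (r.1 a)) K
  obtain ⟨g, hgK, hgm, hg⟩ := hA.exists_total hK hr
    (fun a => IsRandomVariable.eval hm (hrm.comp fun r => r.1 a))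
    (ENNReal.div_pos hε.ne' (by finiteness : ((R.card : ℝ≥0∞) + 1) ≠ ∞))
  refine ⟨fun x => g x * (r x).1⁻¹, fun x => G.mul_mem (hKG (hgK x)) (G.inv_mem (hRG _ (r x).2)),
    fun a => IsRandomVariable.eval hgm (hrm.comp fun r => r.1⁻¹ a), fun f hf => ?_⟩
  -- `r` depends on both coordinates, so `(r x)⁻¹ (f x.1)` is not an allowed test variable; the
  -- union runs over all fixed `ρ ∈ R` instead.
  refine lt_of_le_of_lt (measure_mono ?_) (measure_biUnion_finset_lt volume R
    (fun ρ => {x : I × I | g x (ρ⁻¹ (f x.1)) ≠ (h x ∘ (r x).1) (ρ⁻¹ (f x.1))}) hε hε'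
    fun ρ _ => hg _ (hf.comp fun a => ρ⁻¹ a))
  intro x hx
  refine Set.mem_biUnion (r x).2 ?_
  simpa using hx

end FiniteIndex

/-! ### Isomorphisms of topological groups -/

section TopologicalIso

variable {M : Type u} {N : Type v} {G : Subgroup (Equiv.Perm M)} {H : Subgroup (Equiv.Perm N)}

/-- The action of a continuous image at a point depends on finitely many values only. -/
theorem exists_finset_of_continuous (φ : G →* H) (hφ : Continuous φ) (b : N) :
    ∃ T : Finset M, ∀ g g' : G, (∀ a ∈ T, g.1 a = g'.1 a) → (φ g).1 b = (φ g').1 b := by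
  let _ : TopologicalSpace M := ⊥
  let _ : TopologicalSpace N := ⊥
  have : DiscreteTopology M := ⟨rfl⟩
  have : DiscreteTopology N := ⟨rfl⟩
  have hN : Continuous (fun g : Equiv.Perm N => (g : N → N)) := continuous_induced_dom
  have hopen : IsOpen {g : G | (φ g).1 b = b} :=
    (isOpen_discrete {b}).preimage
      ((continuous_apply b).comp (hN.comp (continuous_subtype_val.comp hφ)))
  have hind : Topology.IsInducing (fun g : G => (g.1 : M → M)) :=
    Topology.IsInducing.comp (g := fun g : Equiv.Perm M => (g : M → M)) ⟨rfl⟩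
      Topology.IsInducing.subtypeVal
  obtain ⟨o, ho, hoeq⟩ := hind.isOpen_iff.1 hopen
  have h1 : ((1 : G).1 : M → M) ∈ o := by
    have : (1 : G) ∈ {g : G | (φ g).1 b = b} := by simp
    rwa [← hoeq] at this
  obtain ⟨T, w, hw, hsub⟩ := isOpen_pi_iff.1 ho _ h1
  refine ⟨T, fun g g' hgg => ?_⟩
  -- The pullback of the stabilizer of `b` is open, hence contains the pointwise stabilizer of `T`.
  have hmem : g⁻¹ * g' ∈ {g : G | (φ g).1 b = b} := by
    rw [← hoeq]
    refine hsub fun a ha => ?_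
    have : (g⁻¹ * g').1 a = a := by
      simp [← hgg a ha]
    change (g⁻¹ * g').1 a ∈ w a
    rw [this]
    exact (hw a ha).2
  have h2 : (φ g).1⁻¹ ((φ g').1 b) = b := by simpa using hmem
  rw [Equiv.Perm.inv_eq_iff_eq] at h2
  exact h2.symm

/-- A finite set of values suffices for all points at once, up to translation. -/
theorem exists_uniform_support (φ : G ≃* H) (hφ : Continuous φ) (hH : IsOligomorphicPermGroup H) :
    ∃ (S : Finset M) (τ : M → N → M), ∀ b, ∀ g g' : G,
      (∀ a ∈ S, g.1 (τ a b) = g'.1 (τ a b)) → (φ g).1 b = (φ g').1 b := by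
  classical
  choose T hT using exists_finset_of_continuous φ.toMonoidHom hφ
  obtain ⟨F, hF⟩ := exists_finset_of_finite_orbits (hH.finite_orbits 1)
  have hk : ∀ b, ∃ k : H, k.1 b ∈ F := fun b => by
    obtain ⟨k, hk, hkF⟩ := hF {b} (by simp)
    exact ⟨⟨k, hk⟩, hkF b (by simp)⟩
  choose k hk using hk
  -- The value of `φ g` at `b` is that of `φ (g * φ.symm (k b)⁻¹)` at `k b b`, a point of the finite
  -- set `F`.
  refine ⟨F.biUnion T, fun a b => (φ.symm (k b)⁻¹).1 a, fun b g g' hgg => ?_⟩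
  have := hT ((k b).1 b) (g * φ.symm (k b)⁻¹) (g' * φ.symm (k b)⁻¹)
    fun a ha => hgg a (Finset.mem_biUnion.2 ⟨_, hk b, ha⟩)
  simpa using this

theorem PermGroupHasARE.of_continuousMulEquiv [Countable M] [Countable N]
    (hG : IsOligomorphicPermGroup G) (hH : IsOligomorphicPermGroup H) (φ : G ≃ₜ* H)
    (hA : PermGroupHasARE G) : PermGroupHasARE H := by
  classical
  refine permGroupHasARE_of_forall hH.isClosed fun h hh hm ε hε => ?_
  wlog hε' : ε ≠ ∞ generalizing ε
  · obtain ⟨g, hgG, hgm, hg⟩ := this 1 one_pos ENNReal.one_ne_top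
    rw [not_not.1 hε']
    exact ⟨g, hgG, hgm, fun f hf => (hg f hf).trans ENNReal.one_lt_top⟩
  choose T hT using exists_finset_of_continuous φ.symm.toMulEquiv.toMonoidHom φ.symm.continuous
  choose T' hT' using exists_finset_of_continuous φ.toMulEquiv.toMonoidHom φ.continuous
  obtain ⟨S, τ, hτ⟩ := exists_uniform_support φ.toMulEquiv φ.continuous hH
  have happrox : ∀ x (s : Finset N), ∃ k : H, ∀ b ∈ s, k.1 b = h x b := fun x s => by
    obtain ⟨k, hk, hkh⟩ := hh x s
    exact ⟨⟨k, hk⟩, hkh⟩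
  choose κ hκ using happrox
  -- the extension of `φ.symm` to the left-completions, applied to `h`
  let h' : I × I → M → M := fun x a => (φ.symm (κ x (T a))).1 a
  -- The value does not depend on the approximant chosen.
  have hh' : ∀ x a (k : H), (∀ b ∈ T a, k.1 b = h x b) → (φ.symm k).1 a = h' x a :=
    fun x a k hk => hT a k _ fun b hb => (hk b hb).trans (hκ x _ b hb).symm
  have hh'G : ∀ x, InLeftCompletion G (h' x) := fun x s =>
    ⟨(φ.symm (κ x (s.biUnion T))).1, Subtype.property _, fun a ha => hh' x a _ fun b hb =>
      hκ x _ b (Finset.mem_biUnion.2 ⟨a, ha, hb⟩)⟩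
  have hh'm : ∀ a, IsRandomVariable fun x => h' x a := fun a =>
    isRandomVariable_of_finset hm (T a) fun x y hxy =>
      hh' y a _ fun b hb => (hκ x _ b hb).trans (hxy b hb)
  obtain ⟨g, hgG, hgm, hg⟩ := hA.exists_total hG.isClosed hh'G hh'm
    (ENNReal.div_pos hε.ne' (by finiteness : ((S.card : ℝ≥0∞) + 1) ≠ ∞))
  refine ⟨fun x => (φ ⟨g x, hgG x⟩).1, fun x => Subtype.property _, fun b =>
    isRandomVariable_of_finset hgm (T' b) fun x y hxy => hT' b ⟨g x, hgG x⟩ ⟨g y, hgG y⟩ hxy,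
    fun f hf => ?_⟩
  refine lt_of_le_of_lt (measure_mono ?_) (measure_biUnion_finset_lt volume S
    (fun a => {x : I × I | g x (τ a (f x.1)) ≠ h' x (τ a (f x.1))}) hε hε'
    fun a _ => hg _ (hf.comp (τ a)))
  intro x hx
  by_contra hcon
  simp only [Set.mem_iUnion, Set.mem_ofPred_eq, not_exists, not_not] at hcon
  let b := f x.1
  -- `k` agrees with `h x` at `b` and wherever `h' x` needs it at the points `τ a b`; so `φ.symm k`
  -- agrees there with `h' x`, hence with `g x`.
  let k : H := κ x (insert b (S.biUnion fun a => T (τ a b)))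
  have hkb : k.1 b = h x b := hκ x _ b (Finset.mem_insert_self _ _)
  have hgk := hτ b ⟨g x, hgG x⟩ (φ.symm k) fun a ha => by
    refine (hcon a ha).trans (hh' x _ k fun c hc => hκ x _ c ?_).symm
    exact Finset.mem_insert_of_mem (Finset.mem_biUnion.2 ⟨a, ha, hc⟩)
  refine hx (hgk.trans ?_)
  have : φ.toMulEquiv (φ.symm k) = k := φ.apply_symm_apply k
  rw [this]
  exact hkb

end TopologicalIso

theorem mainTheorem3 {M : Type u} {N : Type v} [Countable M] [Countable N]
    (G : Subgroup (Equiv.Perm M)) (H : Subgroup (Equiv.Perm N))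
    (hG : IsOligomorphicPermGroup G) (hH : IsOligomorphicPermGroup H) :
    -- `G × H` and `G ≀ H` are again oligomorphic permutation groups
    (IsOligomorphicPermGroup (permDirectProduct G H) ∧
      IsOligomorphicPermGroup (permWreathProduct G H)) ∧
    -- direct products and wreath products
    (PermGroupHasARE G → PermGroupHasARE H →
      PermGroupHasARE (permDirectProduct G H) ∧ PermGroupHasARE (permWreathProduct G H)) ∧
    -- finite index supergroups
    (∀ K : Subgroup (Equiv.Perm M), IsOligomorphicPermGroup K → K ≤ G → K.IsFiniteRelIndex G →
      PermGroupHasARE K → PermGroupHasARE G) ∧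
    -- isomorphism of topological groups
    (PermGroupHasARE G → Nonempty (G ≃ₜ* H) → PermGroupHasARE H) := by
  refine ⟨⟨hG.directProduct hH, hG.wreathProduct hH⟩,
    fun hAG hAH => ⟨hAG.directProduct hG hH hAH, hAG.wreathProduct hG hH hAH⟩,
    fun K hK hKG hfin hA => hA.of_finiteIndex hG.isClosed hK.isClosed hKG hfin, ?_⟩
  rintro hA ⟨φ⟩
  exact hA.of_continuousMulEquiv hG hH φ
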